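/- Let $H$ be a hypergroup, i.e. a non-empty locally compact Hausdorff space such that: (i) the space $M(H)$ of bounded complex regular Borel (Radon) measures on $H$ is an algebra under a convolution $*$, where $\mu*\nu=\int\!\int \delta_x*\delta_y\,d\mu(x)\,d\nu(y)$ is the canonical bilinear extension of the convolution of point masses; (ii) each $\delta_x*\delta_y$ is a probability measure with compact support; (iii) $(x,y)\mapsto\delta_x*\delta_y$ is continuous for the weak topology on probability measures; (iv) $(x,y)\mapsto\operatorname{supp}(\delta_x*\delta_y)$ is continuous for the Michael topology on compact subsets of $H$; (v) there is a (unique) $e\in H$ with $\delta_x*\delta_e=\delta_e*\delta_x=\delta_x$ for all $x$; (vi) there is an involutive homeomorphism $x\mapsto\check x$ of $H$ whose extension to $M(H)$ satisfies $(\mu*\nu)\check{}=\check\nu*\check\mu$; (vii) $e\in\operatorname{supp}(\delta_x*\delta_y)$ if and only if $y=\check x$. For a function $f$ on $H$ and a measure $\mu$ put $(\delta_x*f)(y)=\int f\,d(\delta_{\check x}*\delta_y)$ and $(\mu*f)(x)=\int(\delta_y*f)(x)\,d\mu(y)$. Let $C(H)$ be the Banach space of bounded continuous complex functions on $H$ with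 the supremum norm, $C_C(H)$ the compactly supported continuous complex functions, $C_C(H)^+$ those with values in $[0,\infty)$, and $M^+(H)$ the positive measures in $M(H)$. Let $WUCB_r(H)$ be the space of all $f\in C(H)$ for which $x\mapsto\delta_x*f$ is continuous from $H$ to $C(H)$ with its weak topology. A left invariant mean on $WUCB_r(H)$ is a linear functional $m$ on it with $\|m\|=m(1)=1$ and $m(\delta_x*f)=m(f)$ for all $x\in H$ and $f\in WUCB_r(H)$. A left Haar measure on $H$ is a non-zero regular Borel measure $\lambda$ with values in $[0,\infty]$ such that $\lambda(\delta_x*f)=\lambda(f)$ for all $f\in C_C(H)$ and $x\in H$. For a non-zero $f\in C_C(H)^+$, the positivity property of translations of $f$ says that for all $\mu,\nu\in M^+(H)$, if $\mu*f\le\nu*f$ pointwise on $H$, then $\|\mu\|\le\|\nu\|$. Suppose that there is a left invariant mean on $WUCB_r(H)$. Then the following are equivalent: 1. there is a left Haar measure on $H$; 2. the positivity property of translations of $f$ holds for every non-zero $f\in C_C(H)^+$; 3. the positivity property of translations of $f$ holds for some non-zero $f\in C_C(H)^+$. -/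

import Mathlib

open MeasureTheory Topology
open scoped BoundedContinuousFunction CompactlySupported

/-- A hypergroup structure on a locally compact Hausdorff space `H` with its Borel `σ`-algebra.
`pointConv x y` is the convolution `δ_x ∗ δ_y` of two point masses.  The convolution of arbitrary
bounded Radon measures is its canonical bilinear extension
`(μ ∗ ν)(f) = ∫ ∫ (δ_x ∗ δ_y)(f) dν(y) dμ(x)`, so that all the axioms of the convolution algebra
`M(H)` are axioms about point masses. -/
class Hypergroup (H : Type*) [TopologicalSpace H] [T2Space H] [LocallyCompactSpace H]
    [MeasurableSpace H] [BorelSpace H] where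
  /-- The probability measure `δ_x ∗ δ_y`. -/
  pointConv : H → H → ProbabilityMeasure H
  /-- `δ_x ∗ δ_y` is a Radon measure. -/
  regular_pointConv : ∀ x y, (pointConv x y : Measure H).Regular
  /-- Associativity of the convolution, `(δ_x ∗ δ_y) ∗ δ_z = δ_x ∗ (δ_y ∗ δ_z)`: both measures
  have the same integrals of bounded continuous functions. -/
  pointConv_assoc : ∀ (x y z : H) (f : H →ᵇ ℝ),
    (∫ t, ∫ s, f s ∂(pointConv t z : Measure H) ∂(pointConv x y : Measure H)) =
      ∫ t, ∫ s, f s ∂(pointConv x t : Measure H) ∂(pointConv y z : Measure H)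
  /-- `δ_x ∗ δ_y` has compact support. -/
  isCompact_support : ∀ x y, IsCompact (pointConv x y : Measure H).support
  /-- `(x, y) ↦ δ_x ∗ δ_y` is continuous for the weak topology on probability measures. -/
  continuous_pointConv : Continuous fun p : H × H => pointConv p.1 p.2
  /-- `(x, y) ↦ supp (δ_x ∗ δ_y)` is continuous for the Michael (Vietoris) topology on the space
  of compact subsets of `H`. -/
  continuous_support : Continuous fun p : H × H =>
    (⟨(pointConv p.1 p.2 : Measure H).support, isCompact_support p.1 p.2⟩ :
      TopologicalSpace.Compacts H)
  /-- The identity element. -/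
  e : H
  pointConv_e : ∀ x, (pointConv x e : Measure H) = Measure.dirac x
  e_pointConv : ∀ x, (pointConv e x : Measure H) = Measure.dirac x
  /-- The involution `x ↦ x̌`. -/
  invol : H ≃ₜ H
  invol_invol : ∀ x, invol (invol x) = x
  /-- `(δ_x ∗ δ_y)ˇ = δ_y̌ ∗ δ_x̌`. -/
  map_invol_pointConv : ∀ x y,
    (pointConv x y : Measure H).map invol = (pointConv (invol y) (invol x) : Measure H)
  e_mem_support_iff : ∀ x y, e ∈ (pointConv x y : Measure H).support ↔ y = invol x

namespace Hypergroup

variable {H : Type*} [TopologicalSpace H] [T2Space H] [LocallyCompactSpace H]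
  [MeasurableSpace H] [BorelSpace H] [Hypergroup H]

/-- The left leftTranslate `δ_x ∗ f` of a function `f`, that is
`(δ_x ∗ f)(y) = f(x̌ ∗ y) = ∫ f d(δ_x̌ ∗ δ_y)`. -/
noncomputable def leftTranslate {E : Type*} [NormedAddCommGroup E] [NormedSpace ℝ E]
    (x : H) (f : H → E) : H → E :=
  fun y => ∫ t, f t ∂(pointConv (invol x) y : Measure H)

/-- The convolution `μ ∗ f` of a measure and a function,
`(μ ∗ f)(x) = ∫ (δ_y ∗ f)(x) dμ(y) = ∫ f(y̌ ∗ x) dμ(y)`. -/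
noncomputable def convFun {E : Type*} [NormedAddCommGroup E] [NormedSpace ℝ E]
    (μ : Measure H) (f : H → E) : H → E :=
  fun x => ∫ y, leftTranslate y f x ∂μ

/-- The left leftTranslate `δ_x ∗ f` of a bounded continuous function, as an element of `C(H)`. -/
noncomputable def translateBCF (x : H) (f : H →ᵇ ℂ) : H →ᵇ ℂ :=
  BoundedContinuousFunction.ofNormedAddCommGroup (leftTranslate x f)
    (by
      have hc : Continuous fun y : H => pointConv (invol x) y :=
        continuous_pointConv.comp (continuous_const.prodMk continuous_id)
      rw [continuous_iff_continuousAt] at hc ⊢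
      intro y
      exact (ProbabilityMeasure.tendsto_iff_forall_integral_rclike_tendsto ℂ).1 (hc y) f)
    ‖f‖
    (fun y => by
      have h := norm_integral_le_of_norm_le_const (μ := (pointConv (invol x) y : Measure H))
        (Filter.Eventually.of_forall fun t => f.norm_coe_le_norm t)
      simpa [leftTranslate] using h)

theorem translateBCF_add (x : H) (f g : H →ᵇ ℂ) :
    translateBCF x (f + g) = translateBCF x f + translateBCF x g := by
  ext y
  exact integral_add (f.integrable _) (g.integrable _)

theorem translateBCF_smul (x : H) (c : ℂ) (f : H →ᵇ ℂ) :
    translateBCF x (c • f) = c • translateBCF x f := by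
  ext y
  exact integral_smul c f

theorem translateBCF_one (x : H) : translateBCF x (1 : H →ᵇ ℂ) = 1 := by
  ext y
  change ∫ _, (1 : ℂ) ∂(pointConv (invol x) y : Measure H) = 1
  simp

variable (H) in
/-- `WUCB_r(H)`: the functions `f ∈ C(H)` for which `x ↦ δ_x ∗ f` is continuous from `H` to `C(H)`
with its weak topology. -/
noncomputable def WUCB : Submodule ℂ (H →ᵇ ℂ) where
  carrier := {f | Continuous fun x : H => toWeakSpace ℂ (H →ᵇ ℂ) (translateBCF x f)}
  add_mem' {f g} hf hg := by
    change Continuous _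
    simp only [translateBCF_add, map_add]
    exact Continuous.add hf hg
  zero_mem' := by
    change Continuous _
    have h : ∀ x : H, translateBCF x (0 : H →ᵇ ℂ) = 0 := fun x => by
      simpa using translateBCF_smul x 0 0
    simp only [h]
    exact continuous_const
  smul_mem' c f hf := by
    change Continuous _
    simp only [translateBCF_smul, map_smul]
    exact Continuous.const_smul hf c

theorem one_mem_WUCB : (1 : H →ᵇ ℂ) ∈ WUCB H := by
  change Continuous _
  simp only [translateBCF_one]
  exact continuous_const

/-- A left invariant mean on `WUCB_r(H)`: a linear functional `m` with `‖m‖ = m(1) = 1` and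
`m(δ_x ∗ f) = m(f)` for all `x ∈ H` and `f ∈ WUCB_r(H)`. -/
structure IsLeftInvariantMean (m : WUCB H →L[ℂ] ℂ) : Prop where
  norm_eq_one : ‖m‖ = 1
  map_one : m ⟨1, one_mem_WUCB⟩ = 1
  map_translate : ∀ (x : H) (f g : WUCB H),
    (g : H →ᵇ ℂ) = translateBCF x (f : H →ᵇ ℂ) → m g = m f

/-- A left Haar measure: a non-zero regular Borel measure `lam` with `lam(δ_x ∗ f) = lam(f)` for
all `x ∈ H` and `f ∈ C_C(H)`. -/
structure IsLeftHaarMeasure (lam : Measure H) : Prop where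
  ne_zero : lam ≠ 0
  regular : lam.Regular
  integral_translate : ∀ (x : H) (f : C_c(H, ℂ)),
    ∫ y, leftTranslate x f y ∂lam = ∫ y, f y ∂lam

/-- The positivity property of translations of `f`: for all positive bounded regular Borel
measures `μ, ν`, if `μ ∗ f ≤ ν ∗ f` pointwise then `‖μ‖ ≤ ‖ν‖` (the norm of a positive measure is
its total mass). -/
def PositivityOfTranslations (f : H → ℝ) : Prop :=
  ∀ (μ ν : Measure H) [IsFiniteMeasure μ] [IsFiniteMeasure ν] [μ.Regular] [ν.Regular],
    (∀ x, convFun μ f x ≤ convFun ν f x) → μ Set.univ ≤ ν Set.univ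

end Hypergroup

/-!
A left Haar measure `lam` satisfies `lam(μ ∗ f) = ‖μ‖ lam(f)` by Fubini, and `0 < lam(f) < ∞` for
non-zero `f ∈ C_C(H)⁺`, so integrating `μ ∗ f ≤ ν ∗ f` gives `‖μ‖ ≤ ‖ν‖`. As `H` need not be
`σ`-compact, Fubini's theorem is only available for compactly supported continuous functions on
`H × H`; the measures are therefore replaced by `χ μ` with `χ ∈ C_C(H)`
(`integral_integral_cutoff`, `IsLeftHaarMeasure.positivityOfTranslations`).

Conversely, let `f` have the positivity property. Then `μ ∗ f - ν ∗ f ↦ ‖μ‖ - ‖ν‖` is a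
well-defined positive functional on a subspace of `C_C(H)`. Finitely many translates of `f`
dominate any given function in `C_C(H)` (`exists_le_sum_translateCc`), so the M. Riesz extension
theorem extends it to a positive functional on `C_C(H)` (`exists_positive_functional`), given by a
Radon measure `L`. For `g ∈ C_C(H)` let `F_g(y) = L(δ_y̌ ∗ g)` (`orbitFun`). Domination by
translates of `f` makes `F_g` bounded, associativity gives `F_{δ_x ∗ g} = δ_x ∗ F_g`
(`orbitFun_leftTranslate`), and together these make `x ↦ δ_x ∗ F_g` norm continuous, so that
`F_g ∈ WUCB_r(H)`. Applying the left invariant mean `m`, the functional `g ↦ Re m(F_g)` is positive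
and left invariant, and it is non-zero since `F_f = 1`; the measure representing it is a left Haar
measure (`exists_isLeftHaarMeasure`).

Both directions rest on the support calculus of `H`: `z ∈ supp (δ_y̌ ∗ δ_x)` if and only if
`x ∈ supp (δ_y ∗ δ_z)` (`mem_support_invol_iff`). It bounds the supports of translates and shows
that the translates of `f` cover `H`.
-/

namespace Hypergroup

/-! ### Supports and cutoffs for regular measures -/

theorem eq_zero_of_mem_support {X : Type*} [TopologicalSpace X] [MeasurableSpace X]
    {ν : Measure X} {h : X → ℝ} (hc : Continuous h) (h0 : ∀ x, 0 ≤ h x) (hi : Integrable h ν)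
    (hz : ∫ x, h x ∂ν = 0) {x : X} (hx : x ∈ ν.support) : h x = 0 := by
  by_contra hne
  have hae := (integral_eq_zero_iff_of_nonneg h0 hi).1 hz
  exact Measure.subset_compl_support_of_isOpen (hc.isOpen_preimage _ isOpen_compl_singleton)
    hae (show x ∈ h ⁻¹' {0}ᶜ from hne) hx

/-- An integral against a regular measure only sees the values of the function on the support. -/
theorem exists_mem_support_of_integral_ne_zero {X : Type*} [TopologicalSpace X]
    [MeasurableSpace X] {ν : Measure X} [ν.Regular] {f : X → ℝ}
    (h : ∫ t, f t ∂ν ≠ 0) : ∃ t ∈ ν.support, f t ≠ 0 := by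
  by_contra! hcon
  refine h (integral_eq_zero_of_ae ?_)
  filter_upwards [Measure.support_mem_ae_of_regular (μ := ν)] with t ht using hcon t ht

/-- A finite regular measure has almost all of its mass visible to a cutoff function in `C_C(X)`. -/
theorem exists_cutoff_integral_ge {X : Type*} [TopologicalSpace X] [T2Space X]
    [LocallyCompactSpace X] [MeasurableSpace X] [BorelSpace X] (μ : Measure X)
    [IsFiniteMeasure μ] [μ.Regular] {ε : ℝ} (hε : 0 < ε) :
    ∃ χ : C_c(X, ℝ), (∀ x, 0 ≤ χ x) ∧ (∀ x, χ x ≤ 1) ∧ μ.real Set.univ - ε ≤ ∫ x, χ x ∂μ := by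
  obtain ⟨K, -, hK, hμK⟩ := MeasurableSet.univ.exists_isCompact_lt_add (measure_ne_top μ _)
    (ENNReal.ofReal_pos.2 hε).ne'
  obtain ⟨χ, h1, -, hc, h01⟩ := exists_continuous_one_zero_of_isCompact hK isClosed_empty
    (Set.disjoint_empty K)
  let ψ : C_c(X, ℝ) := ⟨χ, hc⟩
  refine ⟨ψ, fun x => (h01 x).1, fun x => (h01 x).2, ?_⟩
  have hle : μ.real Set.univ ≤ μ.real K + ε := by
    have := ENNReal.toReal_mono (by finiteness) hμK.le
    rwa [ENNReal.toReal_add (measure_ne_top _ _) ENNReal.ofReal_ne_top,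
      ENNReal.toReal_ofReal hε.le] at this
  have hK1 : μ.real K ≤ ∫ x, ψ x ∂μ := by
    calc μ.real K = ∫ x in K, ψ x ∂μ := by
          rw [setIntegral_congr_fun (f := ψ) hK.measurableSet h1]
          simp
      _ ≤ ∫ x, ψ x ∂μ := setIntegral_le_integral ψ.integrable
          (Filter.Eventually.of_forall fun x => (h01 x).1)
  linarith

variable {H : Type*} [TopologicalSpace H] [T2Space H] [LocallyCompactSpace H]
  [MeasurableSpace H] [BorelSpace H] [Hypergroup H]

/-! ### Supports of convolutions of point masses -/

instance (x y : H) : (pointConv x y : Measure H).Regular := regular_pointConv x y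

theorem support_pointConv_nonempty (x y : H) :
    (pointConv x y : Measure H).support.Nonempty := by
  obtain ⟨t, ht, -⟩ := exists_mem_support_of_integral_ne_zero
    (ν := (pointConv x y : Measure H)) (f := fun _ => 1) (by simp)
  exact ⟨t, ht⟩

theorem continuous_integral_pointConv (f : H →ᵇ ℝ) :
    Continuous fun p : H × H => ∫ t, f t ∂(pointConv p.1 p.2 : Measure H) := by
  have hc := continuous_pointConv (H := H)
  rw [continuous_iff_continuousAt] at hc ⊢
  exact fun p => ProbabilityMeasure.tendsto_iff_forall_integral_tendsto.1 (hc p) f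

theorem continuous_leftTranslate_uncurry (f : H →ᵇ ℝ) :
    Continuous fun p : H × H => leftTranslate p.1 f p.2 :=
  (continuous_integral_pointConv f).comp
    ((invol.continuous.comp continuous_fst).prodMk continuous_snd)

/-- The product `A * B` of two sets: the union of the supports of `δ_x ∗ δ_y`, for `x ∈ A` and
`y ∈ B`. -/
def setConv (A B : Set H) : Set H :=
  {z | ∃ x ∈ A, ∃ y ∈ B, z ∈ (pointConv x y : Measure H).support}

/-- By continuity of `(x, y) ↦ supp (δ_x ∗ δ_y)`, the product is the union of a compact family of
compact sets. -/
theorem isCompact_setConv {A B : Set H} (hA : IsCompact A) (hB : IsCompact B) :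
    IsCompact (setConv A B) := by
  have h := TopologicalSpace.Compacts.isCompact_biUnion_coe_of_isCompact
    ((hA.prod hB).image (continuous_support (H := H)))
  convert h using 1
  ext z
  simp [setConv, and_assoc]

theorem invol_e : invol (e : H) = e := by
  have h := (e_mem_support_iff (e : H) e).1 (by
    rw [pointConv_e, Measure.mem_support_iff_forall]
    intro U hU
    simp [Measure.dirac_apply_of_mem (mem_of_mem_nhds hU)])
  exact h.symm

theorem mem_support_invol {x y z : H} (h : z ∈ (pointConv x y : Measure H).support) :
    invol z ∈ (pointConv (invol y) (invol x) : Measure H).support := by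
  rw [← map_invol_pointConv, Measure.mem_support_iff_forall]
  intro U hU
  rw [invol.measurableEmbedding.map_apply]
  exact (Measure.mem_support_iff_forall z).1 h _ (invol.continuous.continuousAt hU)

/-- One half of `mem_support_invol_iff`. The idea is `e ∈ ž ∗ z ⊆ ž ∗ (y̌ ∗ x) = (y ∗ z)ˇ ∗ x`, which
forces `x ∈ y ∗ z`; supports of triple convolutions are avoided by testing associativity on a
non-negative function `g` with `g(e) = 1` that vanishes on `(y ∗ z)ˇ ∗ x`. -/
theorem mem_support_of_mem_support_invol {x y z : H}
    (h : z ∈ (pointConv (invol y) x : Measure H).support) :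
    x ∈ (pointConv y z : Measure H).support := by
  by_contra hx
  set S := (pointConv y z : Measure H).support with hS
  have hSc : IsCompact S := isCompact_support y z
  have hK := isCompact_setConv (hSc.image invol.continuous) (isCompact_singleton (x := x))
  have heK : e ∉ setConv (invol '' S) {x} := by
    rintro ⟨_, ⟨w, hw, rfl⟩, _, rfl, hwe⟩
    rw [e_mem_support_iff, invol_invol] at hwe
    exact hx (hwe ▸ hw)
  obtain ⟨f, hf1, hf0, -, hf01⟩ := exists_continuous_one_zero_of_isCompact
    (isCompact_singleton (x := (e : H))) hK.isClosed (Set.disjoint_singleton_left.2 heK)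
  let g : H →ᵇ ℝ := BoundedContinuousFunction.ofNormedAddCommGroup f f.continuous 1
    (fun t => by rw [Real.norm_of_nonneg (hf01 t).1]; exact (hf01 t).2)
  have hassoc := pointConv_assoc (invol z) (invol y) x g
  -- The side `(δ_ž ∗ δ_y̌) ∗ δ_x` of associativity is carried by the set on which `g` vanishes.
  have h0 : ∫ t, ∫ s, g s ∂(pointConv t x : Measure H)
      ∂(pointConv (invol z) (invol y) : Measure H) = 0 := by
    by_contra hne
    obtain ⟨t, ht, hne⟩ := exists_mem_support_of_integral_ne_zero hne
    obtain ⟨s, hs, hne⟩ := exists_mem_support_of_integral_ne_zero hne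
    have ht' := mem_support_invol ht
    rw [invol_invol, invol_invol] at ht'
    exact hne (hf0 ⟨t, ⟨_, ht', invol_invol t⟩, x, rfl, hs⟩)
  rw [h0] at hassoc
  have hcont : Continuous fun t => ∫ s, g s ∂(pointConv (invol z) t : Measure H) :=
    (continuous_integral_pointConv g).comp (continuous_const.prodMk continuous_id)
  have hbd : ∀ t, ‖∫ s, g s ∂(pointConv (invol z) t : Measure H)‖ ≤ ‖g‖ := fun t => by
    simpa using norm_integral_le_of_norm_le_const (μ := (pointConv (invol z) t : Measure H))
      (Filter.Eventually.of_forall fun t => g.norm_coe_le_norm t)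
  -- The other side `δ_ž ∗ (δ_y̌ ∗ δ_x)` charges `g` near `e`, because `z ∈ supp (δ_y̌ ∗ δ_x)`.
  have hzero := eq_zero_of_mem_support hcont (fun t => integral_nonneg fun s => (hf01 s).1)
    ((BoundedContinuousFunction.ofNormedAddCommGroup _ hcont _ hbd).integrable _) hassoc.symm h
  have he := eq_zero_of_mem_support g.continuous (fun s => (hf01 s).1) (g.integrable _) hzero
    ((e_mem_support_iff (invol z) z).2 (invol_invol z).symm)
  have : g e = 1 := hf1 rfl
  linarith

theorem mem_support_invol_iff {x y z : H} :
    z ∈ (pointConv (invol y) x : Measure H).support ↔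
      x ∈ (pointConv y z : Measure H).support := by
  refine ⟨mem_support_of_mem_support_invol, fun h => mem_support_of_mem_support_invol ?_⟩
  rwa [invol_invol]

/-- Left translations act transitively on `H`, in the sense of supports. -/
theorem exists_mem_support_invol (u z : H) :
    ∃ x, u ∈ (pointConv (invol x) z : Measure H).support := by
  obtain ⟨x, hx⟩ := support_pointConv_nonempty u (invol z)
  refine ⟨invol x, mem_support_invol_iff.2 ?_⟩
  have h := mem_support_invol (mem_support_invol_iff.2 hx)
  rwa [invol_invol, invol_invol] at h

/-! ### Translates of compactly supported functions -/

/-- The translates `δ_x ∗ f` with `x ∈ A` vanish outside `A * supp f`. -/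
theorem mem_setConv_of_leftTranslate_ne_zero {A : Set H} {x y : H} (hx : x ∈ A) {f : H → ℝ}
    (h : leftTranslate x f y ≠ 0) : y ∈ setConv A (tsupport f) := by
  obtain ⟨t, ht, hft⟩ := exists_mem_support_of_integral_ne_zero h
  exact ⟨x, hx, t, subset_tsupport f hft, mem_support_invol_iff.1 ht⟩

theorem norm_leftTranslate_le (f : H →ᵇ ℝ) (x y : H) : ‖leftTranslate x f y‖ ≤ ‖f‖ := by
  simpa [leftTranslate] using
    norm_integral_le_of_norm_le_const (μ := (pointConv (invol x) y : Measure H))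
      (Filter.Eventually.of_forall fun t => f.norm_coe_le_norm t)

theorem integrable_leftTranslate (f : H →ᵇ ℝ) (x : H) (μ : Measure H) [IsFiniteMeasure μ] :
    Integrable (fun y => leftTranslate y f x) μ :=
  (BoundedContinuousFunction.ofNormedAddCommGroup _
    ((continuous_leftTranslate_uncurry f).comp (continuous_id.prodMk continuous_const)) _
    (fun y => norm_leftTranslate_le f y x)).integrable μ

/-- The left translate `δ_x ∗ f` of a compactly supported continuous function, as an element of
`C_C(H)`. -/
noncomputable def translateCc (x : H) (f : C_c(H, ℝ)) : C_c(H, ℝ) where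
  toFun := leftTranslate x f
  continuous_toFun := (continuous_leftTranslate_uncurry f.toBoundedContinuousFunction).comp
    (continuous_const.prodMk continuous_id)
  hasCompactSupport' := HasCompactSupport.of_support_subset_isCompact
    (isCompact_setConv (isCompact_singleton (x := x)) f.hasCompactSupport)
    fun _ hy => mem_setConv_of_leftTranslate_ne_zero (Set.mem_singleton x) hy

@[simp]
theorem coe_translateCc (x : H) (f : C_c(H, ℝ)) : ⇑(translateCc x f) = leftTranslate x f := rfl

theorem translateCc_add (x : H) (f g : C_c(H, ℝ)) :
    translateCc x (f + g) = translateCc x f + translateCc x g := by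
  ext y
  exact integral_add f.integrable g.integrable

theorem translateCc_smul (x : H) (c : ℝ) (f : C_c(H, ℝ)) :
    translateCc x (c • f) = c • translateCc x f := by
  ext y
  exact integral_smul c f

theorem translateCc_mono (x : H) {f g : C_c(H, ℝ)} (h : f ≤ g) :
    translateCc x f ≤ translateCc x g :=
  fun _ => integral_mono f.integrable g.integrable h

theorem translateCc_nonneg (x : H) {f : C_c(H, ℝ)} (h : 0 ≤ f) : 0 ≤ translateCc x f :=
  fun _ => integral_nonneg h

theorem leftTranslate_apply_e (x : H) (f : H → ℝ) : leftTranslate x f e = f (invol x) := by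
  rw [leftTranslate, pointConv_e, integral_dirac]

theorem leftTranslate_e (f : H → ℝ) : leftTranslate e f = f := by
  ext y
  rw [leftTranslate, invol_e, e_pointConv, integral_dirac]

/-- Associativity of the convolution, in the form `(δ_x ∗ δ_y) ∗ f = δ_x ∗ (δ_y ∗ f)`. -/
theorem convFun_pointConv (x y : H) (f : H →ᵇ ℝ) :
    convFun (pointConv x y : Measure H) f = leftTranslate x (leftTranslate y f) := by
  ext z
  have h := pointConv_assoc (invol y) (invol x) z f
  simp only [convFun, leftTranslate]
  rw [← h, ← map_invol_pointConv, invol.measurableEmbedding.integral_map]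

theorem convFun_dirac (x : H) (f : H → ℝ) : convFun (Measure.dirac x) f = leftTranslate x f := by
  ext z
  rw [convFun, integral_dirac]

theorem convFun_add_measure (μ ν : Measure H) [IsFiniteMeasure μ] [IsFiniteMeasure ν]
    (f : H →ᵇ ℝ) : convFun (μ + ν) f = convFun μ f + convFun ν f := by
  ext x
  exact integral_add_measure (integrable_leftTranslate f x μ) (integrable_leftTranslate f x ν)

theorem convFun_nnreal_smul_measure (c : NNReal) (μ : Measure H) (f : H → ℝ) :
    convFun (c • μ) f = (c : ℝ) • convFun μ f := by
  ext x
  exact integral_smul_nnreal_measure _ c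

/-- Finitely many translates of a non-zero `f ∈ C_C(H)⁺` cover any compact set. -/
theorem exists_one_le_sum_translateCc {f : C_c(H, ℝ)} (hf : 0 ≤ f) (hf0 : f ≠ 0) {K : Set H}
    (hK : IsCompact K) :
    ∃ (s : Finset H) (c : ℝ), 0 ≤ c ∧ ∀ y ∈ K, 1 ≤ (c • ∑ x ∈ s, translateCc x f) y := by
  classical
  obtain ⟨u, hu⟩ : ∃ u, f u ≠ 0 := by
    by_contra! h
    exact hf0 (CompactlySupportedContinuousMap.ext h)
  have hpos : ∀ z : H, ∃ x, 0 < translateCc x f z := fun z => by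
    obtain ⟨x, hx⟩ := exists_mem_support_invol u z
    refine ⟨x, (translateCc_nonneg x hf z).lt_of_ne' fun h0 => hu ?_⟩
    exact eq_zero_of_mem_support f.continuous hf f.integrable h0 hx
  choose x hx using hpos
  obtain ⟨t, -, ht⟩ := hK.elim_nhds_subcover (fun z => {y | 0 < translateCc (x z) f y})
    (fun z _ => (isOpen_lt continuous_const (translateCc (x z) f).continuous).mem_nhds (hx z))
  set G : C_c(H, ℝ) := ∑ w ∈ t.image x, translateCc w f with hG
  have hGpos : ∀ y ∈ K, 0 < G y := fun y hy => by
    obtain ⟨z, hz, hzy⟩ := Set.mem_iUnion₂.1 (ht hy)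
    rw [hG, CompactlySupportedContinuousMap.sum_apply]
    exact Finset.sum_pos' (fun w _ => translateCc_nonneg w hf y)
      ⟨x z, Finset.mem_image_of_mem x hz, hzy⟩
  obtain ⟨δ, hδ, hδG⟩ := hK.exists_forall_le' (f := G) G.continuous.continuousOn hGpos
  refine ⟨t.image x, δ⁻¹, (inv_pos.2 hδ).le, fun y hy => ?_⟩
  rw [← hG, CompactlySupportedContinuousMap.smul_apply, smul_eq_mul, inv_mul_eq_div,
    one_le_div hδ]
  exact hδG y hy

/-- A function supported in `K` and bounded by `M` lies below `M c` times a sum of translates of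
`f`, where `c` and the translates depend only on `K`. -/
theorem exists_le_sum_translateCc {f : C_c(H, ℝ)} (hf : 0 ≤ f) (hf0 : f ≠ 0) {K : Set H}
    (hK : IsCompact K) :
    ∃ (s : Finset H) (c : ℝ), 0 ≤ c ∧ ∀ (g : C_c(H, ℝ)) (M : ℝ), (∀ y ∉ K, g y = 0) →
      (∀ y, g y ≤ M) → 0 ≤ M → g ≤ (M * c) • ∑ x ∈ s, translateCc x f := by
  obtain ⟨s, c, hc, h⟩ := exists_one_le_sum_translateCc hf hf0 hK
  refine ⟨s, c, hc, fun g M hg hM hM0 y => ?_⟩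
  rw [mul_smul, CompactlySupportedContinuousMap.smul_apply, smul_eq_mul]
  by_cases hy : y ∈ K
  · exact (hM y).trans (le_mul_of_one_le_right hM0 (h y hy))
  · rw [hg y hy]
    refine mul_nonneg hM0 (mul_nonneg hc ?_)
    rw [CompactlySupportedContinuousMap.sum_apply]
    exact Finset.sum_nonneg fun w _ => translateCc_nonneg w hf y

theorem hasCompactSupport_cutoff (χ f : C_c(H, ℝ)) :
    HasCompactSupport (Function.uncurry fun y x => χ y * leftTranslate y f x) := by
  refine HasCompactSupport.of_support_subset_isCompact
    (χ.hasCompactSupport.prod (isCompact_setConv χ.hasCompactSupport f.hasCompactSupport)) ?_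
  rintro ⟨y, x⟩ h
  have hy : y ∈ tsupport χ := subset_tsupport _ (left_ne_zero_of_mul h)
  exact ⟨hy, mem_setConv_of_leftTranslate_ne_zero hy (right_ne_zero_of_mul h)⟩

theorem continuous_cutoff (χ f : C_c(H, ℝ)) :
    Continuous (Function.uncurry fun y x => χ y * leftTranslate y f x) :=
  (χ.continuous.comp continuous_fst).mul
    (continuous_leftTranslate_uncurry f.toBoundedContinuousFunction)

/-- Fubini's theorem for `L((χ μ) ∗ f)`, without `σ`-finiteness of `L`. -/
theorem integral_integral_cutoff (μ L : Measure H) [IsFiniteMeasureOnCompacts μ]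
    [IsFiniteMeasureOnCompacts L] (χ f : C_c(H, ℝ)) :
    ∫ x, ∫ y, χ y * leftTranslate y f x ∂μ ∂L = ∫ y, χ y * ∫ x, leftTranslate y f x ∂L ∂μ := by
  rw [← integral_integral_swap_of_hasCompactSupport (continuous_cutoff χ f)
    (hasCompactSupport_cutoff χ f)]
  simp only [integral_const_mul]

/-! ### A left Haar measure gives the positivity property -/

/-- The function `(χ μ) ∗ f` for `χ, f ∈ C_C(H)`, as an element of `C_C(H)`. -/
noncomputable def cutoffConv (μ : Measure H) [IsFiniteMeasureOnCompacts μ] (χ f : C_c(H, ℝ)) :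
    C_c(H, ℝ) where
  toFun x := ∫ y, χ y * leftTranslate y f x ∂μ
  continuous_toFun := by
    rw [← continuousOn_univ]
    refine continuousOn_integral_of_compact_support χ.hasCompactSupport
      ((continuous_cutoff χ f).comp continuous_swap).continuousOn fun x y _ hy => ?_
    rw [image_eq_zero_of_notMem_tsupport hy, zero_mul]
  hasCompactSupport' := by
    refine HasCompactSupport.of_support_subset_isCompact
      (isCompact_setConv χ.hasCompactSupport f.hasCompactSupport) fun x hx => ?_
    by_contra hS
    refine hx (integral_eq_zero_of_ae (Filter.Eventually.of_forall fun y => ?_))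
    by_contra hy
    exact hS (mem_setConv_of_leftTranslate_ne_zero
      (subset_tsupport _ (left_ne_zero_of_mul hy)) (right_ne_zero_of_mul hy))

theorem cutoffConv_apply (μ : Measure H) [IsFiniteMeasureOnCompacts μ] (χ f : C_c(H, ℝ)) (x : H) :
    cutoffConv μ χ f x = ∫ y, χ y * leftTranslate y f x ∂μ := rfl

variable {lam : Measure H}

/-- The invariance of a left Haar measure is stated for complex functions; this is its real form. -/
theorem IsLeftHaarMeasure.integral_translate_real (h : IsLeftHaarMeasure lam) (x : H)
    (f : C_c(H, ℝ)) : ∫ y, leftTranslate x f y ∂lam = ∫ y, f y ∂lam := by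
  have h0 : (⟨_, Complex.continuous_ofReal⟩ : C(ℝ, ℂ)) 0 = 0 := Complex.ofReal_zero
  have key := h.integral_translate x (f.compLeft ⟨_, Complex.continuous_ofReal⟩)
  rw [CompactlySupportedContinuousMap.coe_compLeft h0] at key
  have h1 : leftTranslate x (Complex.ofReal ∘ f) = fun y => ((leftTranslate x f y : ℝ) : ℂ) :=
    funext fun y => integral_ofReal
  simp only [Function.comp_apply, ContinuousMap.coe_mk] at key
  simp only [h1] at key
  rw [integral_complex_ofReal, integral_complex_ofReal] at key
  exact_mod_cast key

/-- If `lam(f) = 0`, then every compact set is null, being covered by finitely many translates of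
`f`. -/
theorem IsLeftHaarMeasure.integral_pos (h : IsLeftHaarMeasure lam) {f : C_c(H, ℝ)} (hf : 0 ≤ f)
    (hf0 : f ≠ 0) : 0 < ∫ y, f y ∂lam := by
  have := h.regular
  refine (integral_nonneg hf).lt_of_ne' fun hz => h.ne_zero ?_
  rw [← Measure.measure_univ_eq_zero, isOpen_univ.measure_eq_iSup_isCompact]
  simp only [ENNReal.iSup_eq_zero]
  intro K _ hK
  obtain ⟨s, c, hc, hs⟩ := exists_one_le_sum_translateCc hf hf0 hK
  set G : C_c(H, ℝ) := c • ∑ x ∈ s, translateCc x f with hG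
  have hG0 : ∀ y, 0 ≤ G y := fun y => by
    rw [hG, CompactlySupportedContinuousMap.smul_apply, CompactlySupportedContinuousMap.sum_apply]
    exact mul_nonneg hc (Finset.sum_nonneg fun w _ => translateCc_nonneg w hf y)
  have hGint : ∫ y, G y ∂lam = 0 := by
    simp only [hG, CompactlySupportedContinuousMap.smul_apply, smul_eq_mul,
      CompactlySupportedContinuousMap.sum_apply]
    rw [integral_const_mul, integral_finsetSum _ fun x _ => (translateCc x f).integrable]
    simp [h.integral_translate_real, hz]
  have hae := (integral_eq_zero_iff_of_nonneg hG0 G.integrable).1 hGint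
  refine measure_mono_null (fun y hy => ?_) hae
  exact (one_pos.trans_le (hs y hy)).ne'

theorem IsLeftHaarMeasure.integral_cutoffConv (h : IsLeftHaarMeasure lam) (μ : Measure H)
    [IsFiniteMeasureOnCompacts μ] (χ f : C_c(H, ℝ)) :
    ∫ x, cutoffConv μ χ f x ∂lam = (∫ y, χ y ∂μ) * ∫ x, f x ∂lam := by
  have := h.regular
  simp only [cutoffConv_apply]
  rw [integral_integral_cutoff μ lam χ f]
  simp only [h.integral_translate_real, integral_mul_const]

theorem IsLeftHaarMeasure.positivityOfTranslations (h : IsLeftHaarMeasure lam) {f : C_c(H, ℝ)}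
    (hf : 0 ≤ f) (hf0 : f ≠ 0) : PositivityOfTranslations (f : H → ℝ) := by
  intro μ ν _ _ _ _ hle
  have := h.regular
  have hpos := h.integral_pos hf hf0
  set g : H →ᵇ ℝ := f.toBoundedContinuousFunction with hg
  have hint : ∀ (η : Measure H) [IsFiniteMeasure η] (χ : C_c(H, ℝ)) (x : H),
      Integrable (fun y => χ y * leftTranslate y f x) η := fun η _ χ x =>
    (integrable_leftTranslate g x η).bdd_mul χ.continuous.aestronglyMeasurable
      (Filter.Eventually.of_forall χ.toBoundedContinuousFunction.norm_coe_le_norm)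
  have hnn : ∀ x y, 0 ≤ leftTranslate y f x := fun x y => translateCc_nonneg y hf x
  rw [← ENNReal.toReal_le_toReal (measure_ne_top _ _) (measure_ne_top _ _)]
  change μ.real Set.univ ≤ ν.real Set.univ
  refine le_of_forall_pos_sub_le fun ε hε => ?_
  obtain ⟨χ, hχ0, hχ1, hχ⟩ := exists_cutoff_integral_ge μ hε
  refine hχ.trans ?_
  -- The comparison takes place on the compact support `S` of `(χ μ) ∗ f`, where replacing `ν` by
  -- `ψ ν` costs at most `‖f‖ η lam(S)`, which the choice of `η` makes smaller than `δ`.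
  set S := tsupport (cutoffConv μ χ f) with hS
  refine le_of_mul_le_mul_right (le_of_forall_pos_le_add fun δ hδ => ?_) hpos
  obtain ⟨η, hη, hηδ⟩ := exists_pos_mul_lt hδ (‖g‖ * lam.real S)
  obtain ⟨ψ, hψ0, hψ1, hψ⟩ := exists_cutoff_integral_ge ν hη
  have hpt : ∀ x, cutoffConv μ χ f x ≤ cutoffConv ν ψ f x + ‖g‖ * η := fun x => by
    have h1 : cutoffConv μ χ f x ≤ convFun μ f x :=
      integral_mono (hint μ χ x) (integrable_leftTranslate g x μ)
        fun y => mul_le_of_le_one_left (hnn x y) (hχ1 y)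
    have h2 : convFun ν f x - cutoffConv ν ψ f x ≤ ‖g‖ * η := by
      calc _ = ∫ y, (leftTranslate y f x - ψ y * leftTranslate y f x) ∂ν :=
            (integral_sub (integrable_leftTranslate g x ν) (hint ν ψ x)).symm
        _ ≤ ∫ y, (1 - ψ y) * ‖g‖ ∂ν := by
            refine integral_mono ((integrable_leftTranslate g x ν).sub (hint ν ψ x))
              (((integrable_const 1).sub ψ.integrable).mul_const _) fun y => ?_
            have := (le_abs_self _).trans (norm_leftTranslate_le g y x)
            calc _ = (1 - ψ y) * leftTranslate y f x := by ring
              _ ≤ _ := mul_le_mul_of_nonneg_left this (sub_nonneg.2 (hψ1 y))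
        _ ≤ ‖g‖ * η := by
            rw [integral_mul_const, integral_sub (integrable_const _) ψ.integrable, mul_comm]
            refine mul_le_mul_of_nonneg_left ?_ (norm_nonneg _)
            simp
            linarith
    linarith [hle x]
  have hSc : IsCompact S := (cutoffConv μ χ f).hasCompactSupport
  calc (∫ y, χ y ∂μ) * ∫ x, f x ∂lam = ∫ x, cutoffConv μ χ f x ∂lam :=
        (h.integral_cutoffConv μ χ f).symm
    _ = ∫ x in S, cutoffConv μ χ f x ∂lam :=
        (setIntegral_eq_integral_of_forall_compl_eq_zero
          fun x hx => image_eq_zero_of_notMem_tsupport hx).symm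
    _ ≤ ∫ x in S, (cutoffConv ν ψ f x + ‖g‖ * η) ∂lam :=
        integral_mono (cutoffConv μ χ f).integrable.integrableOn
          ((cutoffConv ν ψ f).integrable.integrableOn.add
            (integrableOn_const hSc.measure_lt_top.ne)) hpt
    _ = (∫ x in S, cutoffConv ν ψ f x ∂lam) + ‖g‖ * lam.real S * η := by
        rw [integral_add (cutoffConv ν ψ f).integrable.integrableOn
          (integrableOn_const hSc.measure_lt_top.ne), setIntegral_const, smul_eq_mul]
        ring
    _ ≤ (∫ x, cutoffConv ν ψ f x ∂lam) + δ :=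
        add_le_add (setIntegral_le_integral (cutoffConv ν ψ f).integrable
          (Filter.Eventually.of_forall fun x => integral_nonneg
            fun y => mul_nonneg (hψ0 y) (hnn x y))) hηδ.le
    _ ≤ ν.real Set.univ * (∫ x, f x ∂lam) + δ := by
        rw [h.integral_cutoffConv ν ψ f]
        gcongr
        simpa using integral_mono ψ.integrable (integrable_const (1 : ℝ)) hψ1

/-! ### A positive functional normalised on the translates of `f` -/

/-- The pairs `(g, ‖μ‖ - ‖ν‖)` for `g ∈ C_C(H)` of the form `μ ∗ f - ν ∗ f`, with `μ` and `ν`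
positive bounded regular measures. This is the graph of a functional on a subspace of `C_C(H)` as
soon as `f` has the positivity property. -/
noncomputable def translationGraph (f : C_c(H, ℝ)) : Submodule ℝ (C_c(H, ℝ) × ℝ) where
  carrier := {p | ∃ (μ ν : Measure H) (_ : IsFiniteMeasure μ) (_ : IsFiniteMeasure ν),
    μ.Regular ∧ ν.Regular ∧ (p.1 : H → ℝ) = convFun μ f - convFun ν f ∧
      p.2 = μ.real Set.univ - ν.real Set.univ}
  add_mem' := by
    rintro ⟨g, r⟩ ⟨g', r'⟩ ⟨μ, ν, _, _, _, _, h, hr⟩ ⟨μ', ν', _, _, _, _, h', hr'⟩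
    refine ⟨μ + μ', ν + ν', inferInstance, inferInstance, inferInstance, inferInstance, ?_, ?_⟩
    · have h1 : convFun (μ + μ') f = convFun μ f + convFun μ' f :=
        convFun_add_measure μ μ' f.toBoundedContinuousFunction
      have h2 : convFun (ν + ν') f = convFun ν f + convFun ν' f :=
        convFun_add_measure ν ν' f.toBoundedContinuousFunction
      change ⇑(g + g') = _
      rw [CompactlySupportedContinuousMap.coe_add, h1, h2, h, h']
      abel
    · change r + r' = _
      rw [measureReal_add_apply, measureReal_add_apply, show r = _ from hr, show r' = _ from hr']
      ring
  zero_mem' := ⟨0, 0, inferInstance, inferInstance, inferInstance, inferInstance, by simp, by simp⟩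
  smul_mem' := by
    have key : ∀ (c : NNReal) (g : C_c(H, ℝ)) (r : ℝ) (μ ν : Measure H),
        (g : H → ℝ) = convFun μ f - convFun ν f → r = μ.real Set.univ - ν.real Set.univ →
        ⇑((c : ℝ) • g) = convFun (c • μ) f - convFun (c • ν) f ∧
          c * r = (c • μ).real Set.univ - (c • ν).real Set.univ := by
      intro c g r μ ν h hr
      rw [CompactlySupportedContinuousMap.coe_smul, convFun_nnreal_smul_measure,
        convFun_nnreal_smul_measure, h, ← smul_sub, hr]
      simp [measureReal_nnreal_smul_apply, mul_sub]
    rintro c ⟨g, r⟩ ⟨μ, ν, _, _, _, _, h, hr⟩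
    rcases le_total 0 c with hc | hc
    · lift c to NNReal using hc
      exact ⟨c • μ, c • ν, inferInstance, inferInstance, inferInstance, inferInstance,
        key c g r μ ν h hr⟩
    · obtain ⟨d, rfl⟩ : ∃ d : NNReal, c = -d := 
        ⟨(-c).toNNReal, by rw [Real.coe_toNNReal _ (neg_nonneg.2 hc), neg_neg]⟩
      obtain ⟨h1, h2⟩ := key d g r μ ν h hr
      refine ⟨d • ν, d • μ, inferInstance, inferInstance, inferInstance, inferInstance, ?_, ?_⟩
      · rw [← neg_sub, ← h1]
        ext x
        exact neg_mul _ _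
      · change -(d : ℝ) * r = _
        rw [neg_mul, h2, neg_sub]

/-- The positivity property of translations of `f` says that the functional with graph
`translationGraph f` is positive; this also makes it well defined. -/
theorem nonneg_of_mem_translationGraph {f : C_c(H, ℝ)}
    (hP : PositivityOfTranslations (f : H → ℝ)) {p : C_c(H, ℝ) × ℝ}
    (hp : p ∈ translationGraph f) (h0 : 0 ≤ p.1) : 0 ≤ p.2 := by
  obtain ⟨μ, ν, _, _, _, _, h, hr⟩ := hp
  rw [hr, sub_nonneg]
  refine ENNReal.toReal_mono (measure_ne_top _ _) (hP ν μ fun x => ?_)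
  have h1 : 0 ≤ p.1 x := h0 x
  rw [h] at h1
  exact sub_nonneg.1 h1

theorem convFun_mem_translationGraph {f g : C_c(H, ℝ)} (μ : Measure H) [IsFiniteMeasure μ]
    [μ.Regular] (hg : ⇑g = convFun μ f) : (g, μ.real Set.univ) ∈ translationGraph f :=
  ⟨μ, 0, inferInstance, inferInstance, inferInstance, inferInstance, by
    ext x
    simp [hg, convFun], by simp⟩

theorem translateCc_mem_translationGraph (x : H) (f : C_c(H, ℝ)) :
    (translateCc x f, 1) ∈ translationGraph f := by
  have : (Measure.dirac x).Regular := e_pointConv x ▸ regular_pointConv e x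
  simpa using convFun_mem_translationGraph (g := translateCc x f) (Measure.dirac x)
    (convFun_dirac x f).symm

/-- The positivity property yields a positive functional on all of `C_C(H)` that sends `μ ∗ f` to
`‖μ‖` whenever `μ ∗ f ∈ C_C(H)`, by the M. Riesz extension theorem. -/
theorem exists_positive_functional {f : C_c(H, ℝ)} (hf : 0 ≤ f) (hf0 : f ≠ 0)
    (hP : PositivityOfTranslations (f : H → ℝ)) :
    ∃ Λ : C_c(H, ℝ) →ₚ[ℝ] ℝ, ∀ (g : C_c(H, ℝ)) (μ : Measure H) [IsFiniteMeasure μ] [μ.Regular],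
      ⇑g = convFun μ f → Λ g = μ.real Set.univ := by
  have hzero : ∀ p ∈ translationGraph f, p.1 = 0 → p.2 = 0 := fun p hp h0 => by
    refine le_antisymm ?_ (nonneg_of_mem_translationGraph hP hp h0.ge)
    have := nonneg_of_mem_translationGraph hP (neg_mem hp) (by simp [h0])
    simpa using this
  set Φ := (translationGraph f).toLinearPMap with hΦ
  have hgraph : ∀ x : Φ.domain, ((x : C_c(H, ℝ)), Φ x) ∈ translationGraph f :=
    fun x => Submodule.mem_graph_toLinearPMap hzero x
  have hdom : ∀ {g : C_c(H, ℝ)} {r : ℝ}, (g, r) ∈ translationGraph f → g ∈ Φ.domain :=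
    fun {g r} h => Submodule.mem_map.2 ⟨(g, r), h, rfl⟩
  have : PosSMulMono ℝ C_c(H, ℝ) :=
    ⟨fun c hc g g' hg x => mul_le_mul_of_nonneg_left (hg x) hc⟩
  obtain ⟨Λ, hΛ, hpos⟩ := riesz_extension (PointedCone.positive ℝ C_c(H, ℝ)) Φ
    (fun x hx => nonneg_of_mem_translationGraph hP (hgraph x) hx) (fun y => by
      obtain ⟨s, c, hc, h⟩ := exists_le_sum_translateCc hf hf0 y.hasCompactSupport
      have hle := h (-y) ‖y.toBoundedContinuousFunction‖
        (fun x hx => by simp [image_eq_zero_of_notMem_tsupport hx])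
        (fun x => (neg_le_abs _).trans (y.toBoundedContinuousFunction.norm_coe_le_norm x))
        (norm_nonneg _)
      refine ⟨⟨(‖y.toBoundedContinuousFunction‖ * c) • ∑ x ∈ s, translateCc x f,
        Φ.domain.smul_mem _ (Φ.domain.sum_mem fun x _ =>
        hdom (translateCc_mem_translationGraph x f))⟩, ?_⟩
      exact neg_le_iff_add_nonneg.1 hle)
  refine ⟨PositiveLinearMap.mk₀ Λ hpos, fun g μ _ _ hg => ?_⟩
  have hmem := convFun_mem_translationGraph μ hg
  have h1 : Λ g = Φ ⟨g, hdom hmem⟩ := hΛ ⟨g, hdom hmem⟩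
  refine h1.trans (sub_eq_zero.1 (hzero _ (sub_mem (hgraph ⟨g, hdom hmem⟩) hmem) ?_))
  exact sub_self g

/-! ### Averaging over translations -/

/-- For a measure `L` on `H` and a function `g`, the function `y ↦ L(δ_y̌ ∗ g)`. -/
noncomputable def orbitFun (L : Measure H) (g : H → ℝ) : H → ℝ :=
  fun y => ∫ z, leftTranslate (invol y) g z ∂L

/-- Integration against `L` commutes with convolution by a compactly supported measure. -/
theorem integral_convFun (L η : Measure H) [IsFiniteMeasureOnCompacts L] [IsFiniteMeasure η]
    [η.Regular] (hη : IsCompact η.support) (g : C_c(H, ℝ)) :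
    ∫ z, convFun η g z ∂L = ∫ t, ∫ z, leftTranslate t g z ∂L ∂η := by
  obtain ⟨χ, h1, -, hc, -⟩ := exists_continuous_one_zero_of_isCompact hη isClosed_empty
    (Set.disjoint_empty _)
  have hae : ∀ᵐ t ∂η, χ t = 1 := by
    filter_upwards [Measure.support_mem_ae_of_regular (μ := η)] with t ht using h1 ht
  have key : ∫ z, ∫ t, χ t * leftTranslate t g z ∂η ∂L =
      ∫ t, χ t * ∫ z, leftTranslate t g z ∂L ∂η := integral_integral_cutoff η L ⟨χ, hc⟩ g
  have hl : ∀ z, ∫ t, χ t * leftTranslate t g z ∂η = convFun η g z := fun z =>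
    integral_congr_ae (by filter_upwards [hae] with t ht; rw [ht, one_mul])
  have hr : ∫ t, χ t * ∫ z, leftTranslate t g z ∂L ∂η = ∫ t, ∫ z, leftTranslate t g z ∂L ∂η :=
    integral_congr_ae (by filter_upwards [hae] with t ht; rw [ht, one_mul])
  rw [← hr, ← key]
  exact integral_congr_ae (Filter.Eventually.of_forall fun z => (hl z).symm)

/-- The map `g ↦ L(δ_y̌ ∗ g)` intertwines left translations: `L(δ_y̌ ∗ δ_x ∗ g)` is the integral of
`L(δ_t ∗ g)` over `δ_y̌ ∗ δ_x = (δ_x̌ ∗ δ_y)ˇ`. -/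
theorem orbitFun_leftTranslate (L : Measure H) [IsFiniteMeasureOnCompacts L] (x : H)
    (g : C_c(H, ℝ)) : orbitFun L (leftTranslate x g) = leftTranslate x (orbitFun L g) := by
  ext y
  have h1 : leftTranslate (invol y) (leftTranslate x g) =
      convFun (pointConv (invol y) x : Measure H) g :=
    (convFun_pointConv (invol y) x g.toBoundedContinuousFunction).symm
  have h2 := map_invol_pointConv (invol y) x
  rw [invol_invol] at h2
  simp only [orbitFun, h1]
  rw [integral_convFun L _ (isCompact_support _ _) g, leftTranslate, ← h2,
    invol.measurableEmbedding.integral_map]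
  simp only [orbitFun, invol_invol]

theorem orbitFun_smul (L : Measure H) (c : ℝ) (g : C_c(H, ℝ)) :
    orbitFun L ⇑(c • g) = c • orbitFun L g := by
  ext y
  change ∫ z, translateCc (invol y) (c • g) z ∂L = _
  rw [translateCc_smul]
  exact integral_smul c (translateCc (invol y) g)

theorem orbitFun_neg (L : Measure H) (g : C_c(H, ℝ)) : orbitFun L ⇑(-g) = -orbitFun L g := by
  have h : -g = (-1 : ℝ) • g := by ext x; simp
  rw [h, orbitFun_smul]
  simp

section

variable {L : Measure H} [IsFiniteMeasureOnCompacts L]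

theorem orbitFun_mono {g h : C_c(H, ℝ)} (hgh : g ≤ h) (y : H) :
    orbitFun L g y ≤ orbitFun L h y :=
  integral_mono (translateCc (invol y) g).integrable (translateCc (invol y) h).integrable
    (translateCc_mono (invol y) hgh)

theorem orbitFun_add (g h : C_c(H, ℝ)) : orbitFun L ⇑(g + h) = orbitFun L g + orbitFun L h := by
  ext y
  change ∫ z, translateCc (invol y) (g + h) z ∂L = _
  rw [translateCc_add]
  exact integral_add (translateCc (invol y) g).integrable (translateCc (invol y) h).integrable

theorem orbitFun_sub (g h : C_c(H, ℝ)) : orbitFun L ⇑(g - h) = orbitFun L g - orbitFun L h := by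
  rw [sub_eq_add_neg, orbitFun_add, orbitFun_neg, sub_eq_add_neg]

theorem orbitFun_sum {ι : Type*} (s : Finset ι) (g : ι → C_c(H, ℝ)) :
    orbitFun L ⇑(∑ i ∈ s, g i) = ∑ i ∈ s, orbitFun L (g i) := by
  classical
  induction s using Finset.induction_on with
  | empty => simpa using orbitFun_smul L 0 (0 : C_c(H, ℝ))
  | insert i s hi ih => rw [Finset.sum_insert hi, Finset.sum_insert hi, orbitFun_add, ih]

/-- The map `g ↦ L(δ_y̌ ∗ g)` is bounded in the supremum norms on functions supported in a fixed
compact set: such `g` is dominated by translates of `f`, whose translates all have integral `1`. -/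
theorem exists_abs_orbitFun_le {f : C_c(H, ℝ)} (hf : 0 ≤ f) (hf0 : f ≠ 0)
    (hL : ∀ x y : H, ∫ z, leftTranslate x (leftTranslate y f) z ∂L = 1)
    {K : Set H} (hK : IsCompact K) :
    ∃ C : ℝ, 0 ≤ C ∧ ∀ (g : C_c(H, ℝ)) (M : ℝ), (∀ y ∉ K, g y = 0) → (∀ y, |g y| ≤ M) →
      ∀ y, |orbitFun L g y| ≤ M * C := by
  obtain ⟨s, c, hc, h⟩ := exists_le_sum_translateCc hf hf0 hK
  refine ⟨c * s.card, by positivity, fun g M hg hM y => ?_⟩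
  have hM0 : 0 ≤ M := (abs_nonneg _).trans (hM e)
  have hdom : orbitFun L ((M * c) • ∑ x ∈ s, translateCc x f : C_c(H, ℝ)) y =
      M * (c * s.card) := by
    have h1 : ∀ x, orbitFun L (translateCc x f) y = 1 := fun x => hL (invol y) x
    rw [orbitFun_smul, orbitFun_sum, Pi.smul_apply, Finset.sum_apply]
    simp only [h1, Finset.sum_const, smul_eq_mul, nsmul_eq_mul, mul_one, mul_assoc]
  rw [← hdom]
  refine abs_le'.2 ⟨orbitFun_mono (h g M hg (fun y => (le_abs_self _).trans (hM y)) hM0) y, ?_⟩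
  rw [← Pi.neg_apply, ← orbitFun_neg]
  exact orbitFun_mono (h (-g) M (fun y hy => by simp [hg y hy])
    (fun y => (neg_le_abs _).trans (hM y)) hM0) y

/-- Norm continuity of `x ↦ δ_x ∗ F` for `F(y) = L(δ_y̌ ∗ g)`. Near `x₀` the translates `δ_x ∗ g` are
supported in one compact set and depend uniformly on `x`, so this follows from
`orbitFun_leftTranslate` and `exists_abs_orbitFun_le`. -/
theorem eventually_abs_leftTranslate_orbitFun_sub_le {f : C_c(H, ℝ)} (hf : 0 ≤ f) (hf0 : f ≠ 0)
    (hL : ∀ x y : H, ∫ z, leftTranslate x (leftTranslate y f) z ∂L = 1)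
    (g : C_c(H, ℝ)) (x₀ : H) {ε : ℝ}
    (hε : 0 < ε) :
    ∀ᶠ x in 𝓝 x₀, ∀ y,
      |leftTranslate x (orbitFun L g) y - leftTranslate x₀ (orbitFun L g) y| ≤ ε := by
  obtain ⟨N, hN, hx₀⟩ := exists_compact_mem_nhds x₀
  have hS := isCompact_setConv hN g.hasCompactSupport
  obtain ⟨C, hC, hb⟩ := exists_abs_orbitFun_le hf hf0 hL hS
  obtain ⟨δ, hδ, hδε⟩ := exists_pos_mul_lt hε C
  have hcont := continuous_leftTranslate_uncurry g.toBoundedContinuousFunction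
  have hunif : ∀ᶠ x in 𝓝 x₀, ∀ y ∈ setConv N (tsupport g),
      |leftTranslate x g y - leftTranslate x₀ g y| < δ := by
    refine hS.eventually_forall_of_forall_eventually fun y _ => ?_
    have hc : Continuous fun p : H × H => |leftTranslate p.1 g p.2 - leftTranslate x₀ g p.2| :=
      (hcont.sub (hcont.comp (continuous_const.prodMk continuous_snd))).abs
    exact hc.continuousAt.eventually_lt_const (by simpa using hδ)
  filter_upwards [hunif, hx₀] with x hx hxN y
  have hzero : ∀ w ∈ N, ∀ z ∉ setConv N (tsupport g), leftTranslate w g z = 0 :=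
    fun w hw z hz => by
      by_contra hne
      exact hz (mem_setConv_of_leftTranslate_ne_zero hw hne)
  have hoff : ∀ z ∉ setConv N (tsupport g), (translateCc x g - translateCc x₀ g) z = 0 :=
    fun z hz => by simp [hzero x hxN z hz, hzero x₀ (mem_of_mem_nhds hx₀) z hz]
  have key := hb (translateCc x g - translateCc x₀ g) δ hoff (fun z => by
    by_cases hz : z ∈ setConv N (tsupport g)
    · exact (hx z hz).le
    · rw [hoff z hz, abs_zero]
      exact hδ.le) y
  rw [orbitFun_sub, coe_translateCc, coe_translateCc, orbitFun_leftTranslate,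
    orbitFun_leftTranslate] at key
  exact key.trans (by linarith)

theorem continuous_orbitFun {f : C_c(H, ℝ)} (hf : 0 ≤ f) (hf0 : f ≠ 0)
    (hL : ∀ x y : H, ∫ z, leftTranslate x (leftTranslate y f) z ∂L = 1)
    (g : C_c(H, ℝ)) : Continuous (orbitFun L g) := by
  have h : Continuous fun x => orbitFun L g (invol x) := by
    rw [Metric.continuous_iff']
    intro x₀ ε hε
    filter_upwards [eventually_abs_leftTranslate_orbitFun_sub_le hf hf0 hL g x₀ (half_pos hε)]
      with x hx
    -- Evaluating at `e` recovers `(δ_x ∗ F)(e) = F(x̌)`.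
    have := hx e
    rw [leftTranslate_apply_e, leftTranslate_apply_e] at this
    exact this.trans_lt (half_lt_self hε)
  simpa only [Function.comp_def, invol_invol] using h.comp invol.continuous

theorem exists_mem_WUCB_eq_orbitFun {f : C_c(H, ℝ)} (hf : 0 ≤ f) (hf0 : f ≠ 0)
    (hL : ∀ x y : H, ∫ z, leftTranslate x (leftTranslate y f) z ∂L = 1)
    (g : C_c(H, ℝ)) :
    ∃ φ : WUCB H, ∀ y, (φ : H →ᵇ ℂ) y = (orbitFun L g y : ℂ) := by
  obtain ⟨C, -, hb⟩ := exists_abs_orbitFun_le hf hf0 hL g.hasCompactSupport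
  have hb' : ∀ y, ‖(orbitFun L g y : ℂ)‖ ≤ ‖g.toBoundedContinuousFunction‖ * C := fun y => by
    rw [Complex.norm_real]
    exact hb g _ (fun y hy => image_eq_zero_of_notMem_tsupport hy)
      g.toBoundedContinuousFunction.norm_coe_le_norm y
  let φ : H →ᵇ ℂ := BoundedContinuousFunction.ofNormedAddCommGroup
    (fun y => (orbitFun L g y : ℂ))
    (Complex.continuous_ofReal.comp (continuous_orbitFun hf hf0 hL g)) _ hb'
  have htr : ∀ x y, translateBCF x φ y = ((leftTranslate x (orbitFun L g) y : ℝ) : ℂ) :=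
    fun x y => integral_complex_ofReal
  refine ⟨⟨φ, ?_⟩, fun y => rfl⟩
  refine (toWeakSpaceCLM ℂ (H →ᵇ ℂ)).continuous.comp ?_
  rw [Metric.continuous_iff']
  intro x₀ ε hε
  filter_upwards [eventually_abs_leftTranslate_orbitFun_sub_le hf hf0 hL g x₀ (half_pos hε)]
    with x hx
  refine lt_of_le_of_lt ?_ (half_lt_self hε)
  rw [BoundedContinuousFunction.dist_le (half_pos hε).le]
  intro y
  rw [htr, htr, dist_eq_norm, ← Complex.ofReal_sub, Complex.norm_real]
  exact hx y

end

/-- A mean is positive: if `0 ≤ φ ≤ c`, then `|c - m(φ)| = |m(c - φ)| ≤ c`. -/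
theorem IsLeftInvariantMean.re_nonneg {m : WUCB H →L[ℂ] ℂ} (hm : IsLeftInvariantMean m)
    {φ : WUCB H} {r : H → ℝ} (hφ : ∀ y, (φ : H →ᵇ ℂ) y = r y) (hr : ∀ y, 0 ≤ r y) :
    0 ≤ (m φ).re := by
  set c : ℝ := ‖(φ : H →ᵇ ℂ)‖ with hc
  have hle : ‖(c : ℂ) • (⟨1, one_mem_WUCB⟩ : WUCB H) - φ‖ ≤ c := by
    change ‖(c : ℂ) • (1 : H →ᵇ ℂ) - (φ : H →ᵇ ℂ)‖ ≤ c
    rw [BoundedContinuousFunction.norm_le (norm_nonneg _)]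
    intro y
    have h1 : r y ≤ c := by
      have := (φ : H →ᵇ ℂ).norm_coe_le_norm y
      rw [hφ, Complex.norm_real] at this
      exact (le_abs_self _).trans this
    have h2 : ((c : ℂ) • (1 : H →ᵇ ℂ) - (φ : H →ᵇ ℂ)) y = ((c - r y : ℝ) : ℂ) := by
      simp [hφ]
    rw [h2, Complex.norm_real, Real.norm_of_nonneg (sub_nonneg.2 h1)]
    linarith [hr y]
  have h3 := m.le_opNorm ((c : ℂ) • (⟨1, one_mem_WUCB⟩ : WUCB H) - φ)
  rw [hm.norm_eq_one, one_mul] at h3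
  have h4 := (Complex.re_le_norm _).trans (h3.trans hle)
  rw [map_sub, map_smul, hm.map_one] at h4
  simpa using h4

/-- Invariance on real functions suffices, by splitting into real and imaginary parts. -/
theorem isLeftHaarMeasure_of_real {lam : Measure H} [lam.Regular] (h0 : lam ≠ 0)
    (h : ∀ (x : H) (f : C_c(H, ℝ)), ∫ y, leftTranslate x f y ∂lam = ∫ y, f y ∂lam) :
    IsLeftHaarMeasure lam := by
  refine ⟨h0, inferInstance, fun x f => ?_⟩
  let u : C_c(H, ℝ) := f.compLeft ⟨_, Complex.continuous_re⟩
  let v : C_c(H, ℝ) := f.compLeft ⟨_, Complex.continuous_im⟩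
  have hu : ∀ y, u y = (f y).re := fun y => f.compLeft_apply rfl y
  have hv : ∀ y, v y = (f y).im := fun y => f.compLeft_apply rfl y
  have hsplit : ∀ (ν : Measure H) [IsFiniteMeasureOnCompacts ν],
      ∫ y, f y ∂ν = ((∫ y, u y ∂ν : ℝ) : ℂ) + ((∫ y, v y ∂ν : ℝ) : ℂ) * Complex.I := by
    intro ν _
    simp only [hu, hv]
    exact (integral_re_add_im f.integrable).symm
  have htr : ∀ y, leftTranslate x f y =
      (translateCc x u y : ℂ) + (translateCc x v y : ℂ) * Complex.I := fun y => hsplit _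
  simp only [htr]
  rw [integral_add (translateCc x u).integrable.ofReal
    ((translateCc x v).integrable.ofReal.mul_const _), integral_mul_const,
    integral_complex_ofReal, integral_complex_ofReal, hsplit lam]
  simp only [coe_translateCc, h]

/-- The measure representing `g ↦ Re m(F_g)`, with `F_g(y) = L(δ_y̌ ∗ g)`, is a left Haar measure. -/
theorem exists_isLeftHaarMeasure {m : WUCB H →L[ℂ] ℂ} (hm : IsLeftInvariantMean m)
    {f : C_c(H, ℝ)} (hf : 0 ≤ f) (hf0 : f ≠ 0) (hP : PositivityOfTranslations (f : H → ℝ)) :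
    ∃ lam : Measure H, IsLeftHaarMeasure lam := by
  obtain ⟨Λ, hΛ⟩ := exists_positive_functional hf hf0 hP
  set L := RealRMK.rieszMeasure Λ with hLdef
  have hL : ∀ x y : H, ∫ z, leftTranslate x (leftTranslate y f) z ∂L = 1 := fun x y => by
    change ∫ z, translateCc x (translateCc y f) z ∂L = 1
    rw [RealRMK.integral_rieszMeasure, hΛ _ (pointConv x y : Measure H)]
    · simp
    · exact (convFun_pointConv x y f.toBoundedContinuousFunction).symm
  choose T hT using exists_mem_WUCB_eq_orbitFun hf hf0 hL
  have hadd : ∀ g h, T (g + h) = T g + T h := fun g h => by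
    ext y
    change (T (g + h) : H →ᵇ ℂ) y = (T g : H →ᵇ ℂ) y + (T h : H →ᵇ ℂ) y
    simp [hT, orbitFun_add, -CompactlySupportedContinuousMap.coe_add]
  have hsmul : ∀ (c : ℝ) g, T (c • g) = (c : ℂ) • T g := fun c g => by
    ext y
    change (T (c • g) : H →ᵇ ℂ) y = (c : ℂ) * (T g : H →ᵇ ℂ) y
    simp [hT, orbitFun_smul, -CompactlySupportedContinuousMap.coe_smul]
  let Ψ : C_c(H, ℝ) →ₗ[ℝ] ℝ :=
    { toFun := fun g => (m (T g)).re
      map_add' := fun g h => by rw [hadd, map_add, Complex.add_re]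
      map_smul' := fun c g => by rw [hsmul, map_smul]; simp }
  have hΨpos : ∀ g, 0 ≤ g → 0 ≤ Ψ g := fun g hg =>
    hm.re_nonneg (hT g) fun y => integral_nonneg (translateCc_nonneg (invol y) hg)
  have hinv : ∀ x g, Ψ (translateCc x g) = Ψ g := fun x g => by
    refine congrArg Complex.re (hm.map_translate x (T g) (T (translateCc x g)) ?_)
    ext y
    rw [hT, coe_translateCc, orbitFun_leftTranslate]
    change _ = ∫ t, (T g : H →ᵇ ℂ) t ∂(pointConv (invol x) y : Measure H)
    simp only [hT]
    exact integral_complex_ofReal.symm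
  -- The functional is non-zero, as `L(δ_y̌ ∗ f) = 1` for all `y`.
  have hone : Ψ f = 1 := by
    have h1 : T f = ⟨1, one_mem_WUCB⟩ := by
      ext y
      have := hL (invol y) e
      rw [leftTranslate_e] at this
      rw [hT, orbitFun, this]
      simp
    change (m (T f)).re = 1
    rw [h1, hm.map_one, Complex.one_re]
  let Ψ' := PositiveLinearMap.mk₀ Ψ hΨpos
  have hint : ∀ g : C_c(H, ℝ), ∫ y, g y ∂(RealRMK.rieszMeasure Ψ') = Ψ g :=
    RealRMK.integral_rieszMeasure Ψ'
  refine ⟨RealRMK.rieszMeasure Ψ', isLeftHaarMeasure_of_real (fun h0 => ?_) fun x g => ?_⟩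
  · have := hint f
    rw [h0, integral_zero_measure, hone] at this
    exact zero_ne_one this
  · rw [← coe_translateCc, hint, hint, hinv]

end Hypergroup

theorem corollary4p5 (H : Type*) [TopologicalSpace H] [T2Space H] [LocallyCompactSpace H]
    [MeasurableSpace H] [BorelSpace H] [Hypergroup H]
    (hmean : ∃ m : Hypergroup.WUCB H →L[ℂ] ℂ, Hypergroup.IsLeftInvariantMean m) :
    List.TFAE [
      ∃ lam : Measure H, Hypergroup.IsLeftHaarMeasure lam,
      ∀ f : C_c(H, ℝ), 0 ≤ f → f ≠ 0 → Hypergroup.PositivityOfTranslations (f : H → ℝ),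
      ∃ f : C_c(H, ℝ), 0 ≤ f ∧ f ≠ 0 ∧ Hypergroup.PositivityOfTranslations (f : H → ℝ)] := by
  obtain ⟨m, hm⟩ := hmean
  tfae_have 1 → 2 := fun ⟨_, hlam⟩ _ hf hf0 => hlam.positivityOfTranslations hf hf0
  tfae_have 2 → 3 := fun h => by
    obtain ⟨f, hfc, hf, hne⟩ := exists_continuous_nonneg_pos (Hypergroup.e : H)
    have hf0 : (⟨f, hfc⟩ : C_c(H, ℝ)) ≠ 0 := fun h0 => hne (DFunLike.congr_fun h0 Hypergroup.e)
    exact ⟨⟨f, hfc⟩, hf, hf0, h _ hf hf0⟩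
  tfae_have 3 → 1 := fun ⟨_, hf, hf0, hP⟩ => Hypergroup.exists_isLeftHaarMeasure hm hf hf0 hP
  tfae_finish
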